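/- Fix an integer $d\ge 3$. A $d$-dimensional copula is a function $C:[0,1]^d\to[0,1]$ that is grounded, has uniform one-dimensional margins and is $d$-increasing. A (normalized Archimedean) generator is a continuous non-increasing function $\psi:[0,\infty)\to[0,1]$ with $\psi(0)=1$, $\lim_{z\to\infty}\psi(z)=0=:\psi(\infty)$ and $\psi(1)=\tfrac12$ that is strictly decreasing on $[0,\inf\{z\in[0,\infty]:\psi(z)=0\}]$; its pseudo-inverse is $\varphi(y)=\inf\{z\in[0,\infty]:\psi(z)=y\}$ for $y\in[0,1]$. A $d$-dimensional copula $C$ is Archimedean with generator $\psi$ if $C(x)=\psi(\varphi(x_1)+\dots+\varphi(x_d))$ for all $x\in[0,1]^d$. The Williamson measure of $C$ (or of $\psi$) is the unique Borel probability measure $\gamma$ on $[0,\infty)$ with $\gamma(\{0\})=0$ and $$\psi(z)=\int_{[0,\infty)}\big(\max(1-tz,0)\big)^{d-1}\,d\gamma(t)\qquad\text{for all } z>0.$$ Theorem. Let $C,C_1,C_2,\dots$ be $d$-dimensional Archimedean copulas with generators $\psi,\psi_1,\psi_2,\dots$ and corresponding Williamson measures $\gamma,\gamma_1,\gamma_2,\dots$.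 Then the following assertions are equivalent: (1) $(C_n)_{n\in\mathbb N}$ converges uniformly to $C$ on $[0,1]^d$; (2) $(\gamma_n)_{n\in\mathbb N}$ converges weakly on $[0,\infty)$ to $\gamma$. -/

import Mathlib

open MeasureTheory Filter Topology unitInterval
open scoped NNReal ENNReal

namespace ArchCopula

/-- A `d`-dimensional copula: a function `[0,1]^d → [0,1]` that is grounded, has uniform
one-dimensional margins, and is `d`-increasing (every box `[a, b]` has nonnegative volume). -/
structure IsCopula {d : ℕ} (C : (Fin d → I) → I) : Prop where
  grounded : ∀ x : Fin d → I, (∃ i, x i = 0) → C x = 0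
  margins : ∀ (i : Fin d) (t : I), C (Function.update (fun _ => 1) i t) = t
  increasing : ∀ a b : Fin d → I, a ≤ b →
    0 ≤ ∑ s : Finset (Fin d), (-1 : ℝ) ^ s.card * (C (fun i => if i ∈ s then a i else b i) : ℝ)

/-- The extension of `ψ : [0,∞) → [0,1]` to `[0,∞]` by `ψ(∞) = 0`. -/
noncomputable def extendGen (ψ : ℝ≥0 → I) (z : ℝ≥0∞) : I :=
  if z = ⊤ then 0 else ψ z.toNNReal

/-- The pseudo-inverse `φ(y) = inf {z ∈ [0,∞] : ψ(z) = y}` (with `ψ(∞) = 0`). -/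
noncomputable def pseudoInv (ψ : ℝ≥0 → I) (y : I) : ℝ≥0∞ :=
  sInf {z : ℝ≥0∞ | extendGen ψ z = y}

/-- Archimedean generators: continuous, non-increasing functions `ψ : [0,∞) → [0,1]` with
`ψ(0) = 1` and `ψ(z) → 0` as `z → ∞`, strictly decreasing on `[0, inf {z ∈ [0,∞] : ψ(z) = 0}]`. -/
structure IsGenerator (ψ : ℝ≥0 → I) : Prop where
  continuous : Continuous ψ
  antitone : Antitone ψ
  map_zero : ψ 0 = 1
  tendsto_zero : Tendsto ψ atTop (𝓝 0)
  strictAntiOn : StrictAntiOn (extendGen ψ) (Set.Icc 0 (sInf {z : ℝ≥0∞ | extendGen ψ z = 0}))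

/-- The function `C_ψ(x) = ψ(φ(x₁) + ⋯ + φ(x_d))` on `[0,1]^d`. -/
noncomputable def archimedean (d : ℕ) (ψ : ℝ≥0 → I) (x : Fin d → I) : I :=
  extendGen ψ (∑ i, pseudoInv ψ (x i))

/-- `C` is a `d`-dimensional Archimedean copula and `ψ` is its generator, normalized by
`ψ(1) = 1/2`. -/
structure IsArchimedeanCopula {d : ℕ} (C : (Fin d → I) → I) (ψ : ℝ≥0 → I) : Prop where
  isCopula : IsCopula C
  isGenerator : IsGenerator ψ
  normalized : (ψ 1 : ℝ) = 1 / 2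
  eq_archimedean : ∀ x, C x = archimedean d ψ x

/-- The Williamson transform `(W_d γ)(z) = ∫ (1 - t z)_+^{d-1} dγ(t)` over `[0,∞)`. -/
noncomputable def williamson (d : ℕ) (γ : Measure ℝ≥0) (z : ℝ≥0) : ℝ :=
  ∫ t : ℝ≥0, (max (1 - (t : ℝ) * (z : ℝ)) 0) ^ (d - 1) ∂γ

/-- `γ` is the Williamson measure of the generator `ψ` in dimension `d`: the probability measure
on `[0,∞)` without mass at `0` whose Williamson transform is `ψ`. -/
structure IsWilliamsonMeasure (d : ℕ) (γ : ProbabilityMeasure ℝ≥0) (ψ : ℝ≥0 → I) : Prop where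
  no_atom_zero : (γ : Measure ℝ≥0) {0} = 0
  eq_williamson : ∀ z : ℝ≥0, 0 < z → (ψ z : ℝ) = williamson d (γ : Measure ℝ≥0) z

end ArchCopula

/-! Both assertions are equivalent to pointwise convergence of the generators. From copulas to
generators: `C(ψ s, ψ t, 1, …, 1) = ψ(s + t)`. The normalization fixes the value at `1`; strict
growth of the diagonal section gives convergence at `2⁻ᵏ` by halving, addition gives the dyadics,
and monotonicity with continuity of `ψ` the rest (`tendsto_generator`). Conversely, monotonicity
makes the convergence joint in index and argument, hence uniform on the compact cube
(`tendstoUniformly_archimedean`). From measures to generators: the Williamson kernel is bounded and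
continuous for fixed `z > 0`. Conversely, Taylor's formula writes a test function `F(1/t)` as a
mixture of kernels, so its integrals converge (`tendsto_integral_comp_inv`). The portmanteau
criterion on open sets then suffices, as `γ` has no mass at `0`. -/

namespace ArchCopula

/-! ### Generators on `[0,∞]` and their pseudo-inverses -/

section Generator

variable {ψ : ℝ≥0 → I}

@[simp] lemma extendGen_top : extendGen ψ ⊤ = 0 := by simp [extendGen]

@[simp] lemma extendGen_coe (z : ℝ≥0) : extendGen ψ z = ψ z := by simp [extendGen]

lemma IsGenerator.antitone_extendGen (h : IsGenerator ψ) : Antitone (extendGen ψ) := by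
  intro a b hab
  induction b with
  | top => simp
  | coe b =>
    lift a to ℝ≥0 using ne_top_of_le_ne_top ENNReal.coe_ne_top hab
    simpa using h.antitone (ENNReal.coe_le_coe.1 hab)

lemma IsGenerator.continuous_extendGen (h : IsGenerator ψ) : Continuous (extendGen ψ) := by
  rw [continuous_iff_continuousAt]
  intro z
  induction z with
  | top =>
    refine tendsto_order.2 ⟨fun a ha => absurd ha (by simp), fun a ha => ?_⟩
    rw [extendGen_top] at ha
    obtain ⟨N, hN⟩ := ((tendsto_order.1 h.tendsto_zero).2 a ha).exists
    filter_upwards [Ioi_mem_nhds (ENNReal.coe_lt_top (r := N))] with w hw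
    exact (h.antitone_extendGen (le_of_lt hw)).trans_lt (by simpa using hN)
  | coe z =>
    rw [ContinuousAt, ENNReal.nhds_coe, tendsto_map'_iff]
    simpa [Function.comp_def] using h.continuous.tendsto z

lemma IsGenerator.surjective_extendGen (h : IsGenerator ψ) (y : I) :
    ∃ z, extendGen ψ z = y := by
  have := intermediate_value_univ (⊤ : ℝ≥0∞) 0 h.continuous_extendGen
  have h0 : extendGen ψ 0 = 1 := by
    rw [← ENNReal.coe_zero, extendGen_coe, h.map_zero]
  rw [extendGen_top, h0] at this
  exact this ⟨y.2.1, y.2.2⟩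

lemma IsGenerator.extendGen_pseudoInv (h : IsGenerator ψ) (y : I) :
    extendGen ψ (pseudoInv ψ y) = y := by
  have hc : IsClosed {z : ℝ≥0∞ | extendGen ψ z = y} :=
    isClosed_eq h.continuous_extendGen continuous_const
  exact hc.sInf_mem (h.surjective_extendGen y)

lemma IsGenerator.lt_extendGen (h : IsGenerator ψ) {y : I} {a : ℝ≥0∞} (ha : a < pseudoInv ψ y) :
    y < extendGen ψ a := by
  refine lt_of_le_of_ne ?_ fun he => ?_
  · simpa [h.extendGen_pseudoInv] using h.antitone_extendGen ha.le
  · exact ha.not_ge (sInf_le he.symm)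

lemma IsGenerator.pseudoInv_le (h : IsGenerator ψ) {y : I} {a : ℝ≥0∞} (ha : extendGen ψ a ≤ y) :
    pseudoInv ψ y ≤ a :=
  not_lt.1 fun hlt => (h.lt_extendGen hlt).not_ge ha

lemma IsGenerator.extendGen_lt (h : IsGenerator ψ) {a b : ℝ≥0∞} (hab : a < b)
    (ha : 0 < extendGen ψ a) : extendGen ψ b < extendGen ψ a := by
  set z := sInf {z : ℝ≥0∞ | extendGen ψ z = 0}
  have hz : extendGen ψ z = 0 := h.extendGen_pseudoInv 0
  rcases le_total b z with hb | hb
  · exact h.strictAntiOn ⟨zero_le, hab.le.trans hb⟩ ⟨zero_le, hb⟩ hab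
  · exact ((h.antitone_extendGen hb).trans_eq hz).trans_lt ha

lemma IsGenerator.pseudoInv_extendGen (h : IsGenerator ψ) {a : ℝ≥0∞} (ha : 0 < extendGen ψ a) :
    pseudoInv ψ (extendGen ψ a) = a := by
  refine le_antisymm (h.pseudoInv_le le_rfl) (not_lt.1 fun hlt => ?_)
  have := h.extendGen_lt hlt (by rwa [h.extendGen_pseudoInv])
  rw [h.extendGen_pseudoInv] at this
  exact this.false

lemma IsGenerator.pseudoInv_one (h : IsGenerator ψ) : pseudoInv ψ 1 = 0 := by
  have h0 : extendGen ψ 0 = 1 := by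
    rw [← ENNReal.coe_zero, extendGen_coe, h.map_zero]
  exact le_antisymm (sInf_le h0) zero_le

lemma IsGenerator.antitone_pseudoInv (h : IsGenerator ψ) : Antitone (pseudoInv ψ) :=
  fun _ _ hab => h.pseudoInv_le (by rwa [h.extendGen_pseudoInv])

lemma IsGenerator.archimedean_le (h : IsGenerator ψ) {d : ℕ} (x : Fin d → I) (i : Fin d) :
    archimedean d ψ x ≤ x i := by
  conv_rhs => rw [← h.extendGen_pseudoInv (x i)]
  exact h.antitone_extendGen
    (Finset.single_le_sum (f := fun i => pseudoInv ψ (x i)) (fun _ _ => zero_le) (Finset.mem_univ i))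

lemma IsGenerator.monotone_archimedean (h : IsGenerator ψ) (d : ℕ) :
    Monotone (archimedean d ψ) :=
  fun _ _ hxy => h.antitone_extendGen (Finset.sum_le_sum fun i _ => h.antitone_pseudoInv (hxy i))

end Generator

/-! ### From pointwise convergence of generators to uniform convergence of copulas -/

section ContinuousConvergence

variable {ψ : ℝ≥0 → I} {ψn : ℕ → ℝ≥0 → I}

/-- By monotonicity, the value of `ψn` at one nearby point bounds it on a whole neighbourhood of
`z`; continuity of the limit makes that bound as sharp as needed. -/
lemma tendsto_extendGen_prod (h : IsGenerator ψ) (hn : ∀ n, IsGenerator (ψn n))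
    (hlim : ∀ z, Tendsto (fun n => ψn n z) atTop (𝓝 (ψ z))) (z : ℝ≥0∞) :
    Tendsto (fun p : ℕ × ℝ≥0∞ => extendGen (ψn p.1) p.2) (atTop ×ˢ 𝓝 z)
      (𝓝 (extendGen ψ z)) := by
  have hlim' : ∀ z, Tendsto (fun n => extendGen (ψn n) z) atTop (𝓝 (extendGen ψ z)) := by
    intro z
    induction z with
    | top => simp
    | coe z => simpa using hlim z
  have hc := h.continuous_extendGen.tendsto z
  refine tendsto_order.2 ⟨fun c hcz => ?_, fun c hcz => ?_⟩
  · by_cases hz : z = ⊤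
    · simp [hz] at hcz
    have : (𝓝[>] z).NeBot := nhdsGT_neBot_of_exists_gt ⟨⊤, lt_top_iff_ne_top.2 hz⟩
    obtain ⟨b, hzb, hb⟩ := ((((tendsto_order.1 hc).1 c hcz).filter_mono
      (nhdsWithin_le_nhds (s := Set.Ioi z))).and self_mem_nhdsWithin).exists
    filter_upwards [prod_mem_prod ((tendsto_order.1 (hlim' b)).1 c hzb) (Iio_mem_nhds hb)]
      with p hp
    exact lt_of_lt_of_le hp.1 ((hn p.1).antitone_extendGen (le_of_lt hp.2))
  · by_cases hz : z = 0
    · rw [hz, ← ENNReal.coe_zero, extendGen_coe, h.map_zero] at hcz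
      exact absurd hcz (not_lt.2 c.2.2)
    have : (𝓝[<] z).NeBot := nhdsLT_neBot_of_exists_lt ⟨0, pos_iff_ne_zero.2 hz⟩
    obtain ⟨b, hzb, hb⟩ := ((((tendsto_order.1 hc).2 c hcz).filter_mono
      (nhdsWithin_le_nhds (s := Set.Iio z))).and self_mem_nhdsWithin).exists
    filter_upwards [prod_mem_prod ((tendsto_order.1 (hlim' b)).2 c hzb) (Ioi_mem_nhds hb)]
      with p hp
    exact lt_of_le_of_lt ((hn p.1).antitone_extendGen (le_of_lt hp.2)) hp.1

/-- The upper bound needs `ψ` to drop strictly just past `pseudoInv ψ y`, which requires `0 < y`. At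
`y = 0` convergence can fail: a `ψ` with a finite zero may be a limit of everywhere positive
generators. -/
lemma tendsto_pseudoInv_prod (h : IsGenerator ψ) (hn : ∀ n, IsGenerator (ψn n))
    (hlim : ∀ z, Tendsto (fun n => ψn n z) atTop (𝓝 (ψ z))) {y : I} (hy : 0 < y) :
    Tendsto (fun p : ℕ × I => pseudoInv (ψn p.1) p.2) (atTop ×ˢ 𝓝 y)
      (𝓝 (pseudoInv ψ y)) := by
  have key : ∀ z, Tendsto (fun p : ℕ × I => extendGen (ψn p.1) z) (atTop ×ˢ 𝓝 y)
      (𝓝 (extendGen ψ z)) := fun z =>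
    (tendsto_extendGen_prod h hn hlim z).comp (tendsto_fst.prodMk (tendsto_const_nhds))
  have hsnd : Tendsto (fun p : ℕ × I => p.2) (atTop ×ˢ 𝓝 y) (𝓝 y) := tendsto_snd
  refine tendsto_order.2 ⟨fun a ha => ?_, fun b hb => ?_⟩
  · obtain ⟨a', haa', ha'⟩ := exists_between ha
    filter_upwards [hsnd.eventually_lt (key a') (h.lt_extendGen ha')] with p hp
    refine haa'.trans_le (not_lt.1 fun hlt => hp.not_ge ?_)
    simpa [(hn p.1).extendGen_pseudoInv] using (hn p.1).antitone_extendGen hlt.le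
  · obtain ⟨b', hb', hbb'⟩ := exists_between hb
    have := h.extendGen_lt hb' (by rwa [h.extendGen_pseudoInv])
    rw [h.extendGen_pseudoInv] at this
    filter_upwards [(key b').eventually_lt hsnd this] with p hp
    exact ((hn p.1).pseudoInv_le hp.le).trans_lt hbb'

lemma tendsto_archimedean_prod (h : IsGenerator ψ) (hn : ∀ n, IsGenerator (ψn n))
    (hlim : ∀ z, Tendsto (fun n => ψn n z) atTop (𝓝 (ψ z))) {d : ℕ} (x : Fin d → I) :
    Tendsto (fun p : ℕ × (Fin d → I) => archimedean d (ψn p.1) p.2) (atTop ×ˢ 𝓝 x)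
      (𝓝 (archimedean d ψ x)) := by
  have hsnd : ∀ i, Tendsto (fun p : ℕ × (Fin d → I) => p.2 i) (atTop ×ˢ 𝓝 x) (𝓝 (x i)) :=
    fun i => ((continuous_apply i).tendsto x).comp tendsto_snd
  -- At a zero coordinate the pseudo-inverses need not converge; the bound by that coordinate
  -- replaces them.
  by_cases hx : ∃ i, x i = 0
  · obtain ⟨i, hi⟩ := hx
    have h0 : archimedean d ψ x = 0 := le_antisymm (hi ▸ h.archimedean_le x i) bot_le
    rw [h0]
    exact tendsto_of_tendsto_of_tendsto_of_le_of_le tendsto_const_nhds (hi ▸ hsnd i)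
      (fun _ => bot_le) (fun p => (hn p.1).archimedean_le p.2 i)
  · push Not at hx
    have hpos : ∀ i, 0 < x i := fun i => lt_of_le_of_ne bot_le (hx i).symm
    refine (tendsto_extendGen_prod h hn hlim _).comp (tendsto_fst.prodMk ?_)
    exact tendsto_finsetSum _ fun i _ =>
      (tendsto_pseudoInv_prod h hn hlim (hpos i)).comp (tendsto_fst.prodMk (hsnd i))

lemma IsGenerator.continuous_archimedean (h : IsGenerator ψ) (d : ℕ) :
    Continuous (archimedean d ψ) := by
  rw [continuous_iff_continuousAt]
  intro x
  have hc : Tendsto (fun p : ℕ × (Fin d → I) => archimedean d ψ p.2) (atTop ×ˢ 𝓝 x)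
      (𝓝 (archimedean d ψ x)) :=
    tendsto_archimedean_prod h (ψn := fun _ => ψ) (fun _ => h) (fun _ => tendsto_const_nhds) x
  have hs : Tendsto (archimedean d ψ) (map Prod.snd ((atTop : Filter ℕ) ×ˢ 𝓝 x))
      (𝓝 (archimedean d ψ x)) := tendsto_map'_iff.2 hc
  rwa [map_snd_prod] at hs

lemma tendstoUniformly_archimedean (h : IsGenerator ψ) (hn : ∀ n, IsGenerator (ψn n))
    (hlim : ∀ z, Tendsto (fun n => ψn n z) atTop (𝓝 (ψ z))) (d : ℕ) :
    TendstoUniformly (fun n => archimedean d (ψn n)) (archimedean d ψ) atTop := by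
  rw [← tendstoLocallyUniformly_iff_tendstoUniformly_of_compactSpace,
    tendstoLocallyUniformly_iff_forall_tendsto]
  intro x
  refine tendsto_uniformity_iff_dist_tendsto_zero.2 ?_
  have := (((h.continuous_archimedean d).tendsto x).comp (tendsto_snd (f := atTop (α := ℕ)))).dist
    (tendsto_archimedean_prod h hn hlim x)
  simpa using this

end ContinuousConvergence

/-! ### Recovering the generator from the copula -/

section Recovery

/-- The point `(a, b, 1, …, 1)` of `[0,1]^d`. -/
def bivariatePoint (d : ℕ) (a b : I) : Fin d → I := fun i =>
  if (i : ℕ) = 0 then a else if (i : ℕ) = 1 then b else 1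

lemma continuous_bivariatePoint (d : ℕ) :
    Continuous fun p : I × I => bivariatePoint d p.1 p.2 := by
  refine continuous_pi fun i => ?_
  unfold bivariatePoint
  split_ifs <;> fun_prop

lemma bivariatePoint_mono (d : ℕ) {a b a' b' : I} (ha : a ≤ a') (hb : b ≤ b') :
    bivariatePoint d a b ≤ bivariatePoint d a' b' := by
  intro i
  unfold bivariatePoint
  split_ifs <;> first | assumption | exact le_rfl

variable {d : ℕ} {ψ : ℝ≥0 → I} {ψn : ℕ → ℝ≥0 → I}

lemma IsGenerator.archimedean_bivariatePoint (h : IsGenerator ψ) (hd : 2 ≤ d) (a b : I) :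
    archimedean d ψ (bivariatePoint d a b) = extendGen ψ (pseudoInv ψ a + pseudoInv ψ b) := by
  obtain ⟨k, rfl⟩ := Nat.exists_eq_add_of_le' hd
  simp [archimedean, Fin.sum_univ_succ, bivariatePoint, h.pseudoInv_one]

/-- The pseudo-inverse undoes `ψ` only where `ψ` is positive; when `ψ s` or `ψ t` is zero, both
sides vanish. -/
lemma IsGenerator.archimedean_bivariatePoint_map (h : IsGenerator ψ) (hd : 2 ≤ d) (s t : ℝ≥0) :
    archimedean d ψ (bivariatePoint d (ψ s) (ψ t)) = ψ (s + t) := by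
  have hzero : ∀ i : Fin d, bivariatePoint d (ψ s) (ψ t) i = 0 → ψ (s + t) = 0 →
      archimedean d ψ (bivariatePoint d (ψ s) (ψ t)) = ψ (s + t) := fun i hi h0 =>
    (le_antisymm ((h.archimedean_le _ i).trans_eq hi) bot_le).trans h0.symm
  rcases eq_or_ne (ψ s) 0 with hs | hs
  · exact hzero ⟨0, by omega⟩ (by simp [bivariatePoint, hs])
      (le_antisymm ((h.antitone le_self_add).trans_eq hs) bot_le)
  rcases eq_or_ne (ψ t) 0 with ht | ht
  · exact hzero ⟨1, by omega⟩ (by simp [bivariatePoint, ht])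
      (le_antisymm ((h.antitone le_add_self).trans_eq ht) bot_le)
  have key : ∀ r : ℝ≥0, ψ r ≠ 0 → pseudoInv ψ (ψ r) = r := fun r hr => by
    have := h.pseudoInv_extendGen (a := r) (by
      rw [extendGen_coe]; exact lt_of_le_of_ne bot_le hr.symm)
    rwa [extendGen_coe] at this
  rw [h.archimedean_bivariatePoint hd, key s hs, key t ht, ← ENNReal.coe_add, extendGen_coe]

lemma IsGenerator.archimedean_diagonal_lt (h : IsGenerator ψ) (hd : 2 ≤ d) {a b : I} (hab : a < b)
    (hb : 0 < archimedean d ψ (bivariatePoint d b b)) :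
    archimedean d ψ (bivariatePoint d a a) < archimedean d ψ (bivariatePoint d b b) := by
  rw [h.archimedean_bivariatePoint hd] at hb ⊢
  rw [h.archimedean_bivariatePoint hd]
  have hlt : pseudoInv ψ b < pseudoInv ψ a := by
    refine lt_of_le_of_ne (h.antitone_pseudoInv hab.le) fun he => hab.ne ?_
    rw [← h.extendGen_pseudoInv a, ← h.extendGen_pseudoInv b, he]
  exact h.extendGen_lt (ENNReal.add_lt_add hlt hlt) hb

/-- The diagonal section sends `ψ s` to `ψ (s + s)` and is strictly increasing at positive values,
so comparing it at `c` and at `ψ s` locates `ψn n s` relative to `c`. -/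
lemma tendsto_generator_half (h : IsGenerator ψ) (hn : ∀ n, IsGenerator (ψn n)) (hd : 2 ≤ d)
    (hC : ∀ x, Tendsto (fun n => archimedean d (ψn n) x) atTop (𝓝 (archimedean d ψ x)))
    {s : ℝ≥0} (hs : Tendsto (fun n => ψn n (s + s)) atTop (𝓝 (ψ (s + s)))) (hpos : 0 < ψ (s + s)) :
    Tendsto (fun n => ψn n s) atTop (𝓝 (ψ s)) := by
  have hmono : ∀ n, Monotone fun a => archimedean d (ψn n) (bivariatePoint d a a) :=
    fun n a b hab => (hn n).monotone_archimedean d (bivariatePoint_mono d hab hab)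
  rw [← h.archimedean_bivariatePoint_map hd] at hs hpos
  simp_rw [← (hn _).archimedean_bivariatePoint_map hd] at hs
  refine tendsto_order.2 ⟨fun c hc => ?_, fun c hc => ?_⟩
  · filter_upwards [(hC _).eventually_lt hs (h.archimedean_diagonal_lt hd hc hpos)] with n hlt
    exact (hmono n).reflect_lt hlt
  · have hle := h.monotone_archimedean d (bivariatePoint_mono d hc.le hc.le)
    filter_upwards [hs.eventually_lt (hC _)
      (h.archimedean_diagonal_lt hd hc (hpos.trans_le hle))] with n hlt
    exact (hmono n).reflect_lt hlt

lemma exists_dyadic_between {a b : ℝ≥0} (hab : a < b) :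
    ∃ m k : ℕ, a < m * (1 / 2) ^ k ∧ m * (1 / 2) ^ k < b := by
  obtain ⟨k, hk⟩ := exists_pow_lt_of_lt_one (tsub_pos_of_lt hab)
    (show (1 / 2 : ℝ≥0) < 1 from NNReal.half_lt_self one_ne_zero)
  have hpos : (0 : ℝ≥0) < (1 / 2) ^ k := by positivity
  refine ⟨⌊a / (1 / 2) ^ k⌋₊ + 1, k, ?_, ?_⟩
  · rw [← div_lt_iff₀ hpos]
    exact_mod_cast Nat.lt_floor_add_one _
  · have h1 : (⌊a / (1 / 2) ^ k⌋₊ : ℝ≥0) * (1 / 2) ^ k ≤ a := by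
      rw [← le_div_iff₀ hpos]
      exact Nat.floor_le zero_le
    calc ((⌊a / (1 / 2) ^ k⌋₊ + 1 : ℕ) : ℝ≥0) * (1 / 2) ^ k
        = ⌊a / (1 / 2) ^ k⌋₊ * (1 / 2) ^ k + (1 / 2) ^ k := by push_cast; ring
      _ ≤ a + (1 / 2) ^ k := by gcongr
      _ < b := lt_tsub_iff_left.1 hk

lemma tendsto_generator (h : IsGenerator ψ) (hn : ∀ n, IsGenerator (ψn n)) (hd : 2 ≤ d)
    (h1 : 0 < ψ 1) (hn1 : Tendsto (fun n => ψn n 1) atTop (𝓝 (ψ 1)))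
    (hC : TendstoUniformly (fun n => archimedean d (ψn n)) (archimedean d ψ) atTop) (z : ℝ≥0) :
    Tendsto (fun n => ψn n z) atTop (𝓝 (ψ z)) := by
  have hpow : ∀ k : ℕ, Tendsto (fun n => ψn n ((1 / 2) ^ k)) atTop (𝓝 (ψ ((1 / 2) ^ k))) := by
    intro k
    induction k with
    | zero => simpa using hn1
    | succ k ih =>
      have hs : (1 / 2 : ℝ≥0) ^ (k + 1) + (1 / 2) ^ (k + 1) = (1 / 2) ^ k := by
        rw [pow_succ, ← mul_add, add_halves, mul_one]
      refine tendsto_generator_half h hn hd (fun x => hC.tendsto_at x) (by rwa [hs]) ?_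
      rw [hs]
      exact h1.trans_le (h.antitone (pow_le_one₀ zero_le (NNReal.half_le_self 1)))
  have hdyadic : ∀ k m : ℕ, Tendsto (fun n => ψn n (m * (1 / 2) ^ k)) atTop
      (𝓝 (ψ (m * (1 / 2) ^ k))) := by
    intro k m
    induction m with
    | zero => simp [h.map_zero, (hn _).map_zero]
    | succ m ih =>
      -- Uniform convergence allows evaluation at the moving points `(ψn n (m/2ᵏ), ψn n (1/2ᵏ))`,
      -- whose copula value is `ψn n ((m+1)/2ᵏ)`.
      have := hC.tendsto_comp (h.continuous_archimedean d).continuousAt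
        (((continuous_bivariatePoint d).tendsto _).comp (ih.prodMk_nhds (hpow k)))
      simp only [Function.comp_def, h.archimedean_bivariatePoint_map hd,
        (hn _).archimedean_bivariatePoint_map hd] at this
      simpa [add_mul] using this
  rcases eq_or_ne z 0 with rfl | hz
  · simp [h.map_zero, (hn _).map_zero]
  have hc := h.continuous.tendsto z
  refine tendsto_order.2 ⟨fun c hcz => ?_, fun c hcz => ?_⟩
  · obtain ⟨b, hzb, hb⟩ := exists_Ico_subset_of_mem_nhds ((tendsto_order.1 hc).1 c hcz)
      (exists_gt z)
    obtain ⟨m, k, h1, h2⟩ := exists_dyadic_between hzb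
    filter_upwards [(tendsto_order.1 (hdyadic k m)).1 c (hb ⟨h1.le, h2⟩)] with n hlt
    exact hlt.trans_le ((hn n).antitone h1.le)
  · obtain ⟨b, hzb, hb⟩ := exists_Ioc_subset_of_mem_nhds ((tendsto_order.1 hc).2 c hcz)
      ⟨0, pos_iff_ne_zero.2 hz⟩
    obtain ⟨m, k, h1, h2⟩ := exists_dyadic_between hzb
    filter_upwards [(tendsto_order.1 (hdyadic k m)).2 c (hb ⟨h1, h2.le⟩)] with n hlt
    exact ((hn n).antitone h2.le).trans_lt hlt

end Recovery

/-! ### Inverting the Williamson transform against smooth test functions -/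

section Inversion

open scoped ContDiff

lemma iteratedDeriv_eq_zero_of_notMem_tsupport {f : ℝ → ℝ} {x : ℝ} (hx : x ∉ tsupport f) (k : ℕ) :
    iteratedDeriv k f x = 0 := by
  have : x ∉ Function.support (iteratedFDeriv ℝ k f) :=
    fun h => hx (support_iteratedFDeriv_subset k h)
  rw [iteratedDeriv_eq_iteratedFDeriv, Function.notMem_support.1 this]
  simp

/-- Taylor's formula at `0` with integral remainder: all derivatives vanish there, so only the
remainder survives, and its integrand extends by zero to the whole line. -/
lemma eq_integral_iteratedDeriv {f : ℝ → ℝ} {n : ℕ} (hn : n ≠ 0) (hf : ContDiff ℝ ∞ f)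
    (hsupp : tsupport f ⊆ Set.Ioi 0) {x : ℝ} (hx : 0 < x) :
    f x = ∫ z, (max (x - z) 0) ^ n * (iteratedDeriv (n + 1) f z / n.factorial) := by
  have hzero : ∀ z ≤ 0, ∀ k, iteratedDeriv k f z = 0 := fun z hz k =>
    iteratedDeriv_eq_zero_of_notMem_tsupport (fun h => (hsupp h).not_ge hz) k
  have hunique : UniqueDiffOn ℝ (Set.uIcc 0 x) := uniqueDiffOn_uIcc hx.ne
  have hwithin : ∀ k, ∀ z ∈ Set.uIcc 0 x,
      iteratedDerivWithin k f (Set.uIcc 0 x) z = iteratedDeriv k f z := fun k z hz =>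
    iteratedDerivWithin_eq_iteratedDeriv hunique
      (hf.contDiffAt.of_le (by exact_mod_cast le_top)) hz
  have htaylor := taylor_integral_remainder (f := f) (x := x) (x₀ := 0) (n := n)
    (hf.contDiffOn.of_le (by exact_mod_cast le_top))
  have h0 : taylorWithinEval f n (Set.uIcc 0 x) 0 x = 0 := by
    rw [taylor_within_apply]
    refine Finset.sum_eq_zero fun k _ => ?_
    rw [hwithin k 0 Set.left_mem_uIcc, hzero 0 le_rfl, smul_zero]
  rw [h0, sub_zero] at htaylor
  rw [htaylor, intervalIntegral.integral_of_le hx.le]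
  rw [← setIntegral_eq_integral_of_forall_compl_eq_zero (s := Set.Ioc 0 x)
    (f := fun z => (max (x - z) 0) ^ n * (iteratedDeriv (n + 1) f z / n.factorial))]
  · refine setIntegral_congr_fun measurableSet_Ioc fun z hz => ?_
    have hz' : z ∈ Set.uIcc 0 x := by rw [Set.uIcc_of_le hx.le]; exact ⟨hz.1.le, hz.2⟩
    simp only [hwithin _ z hz', smul_eq_mul, max_eq_left (sub_nonneg.2 hz.2)]
    ring
  · intro z hz
    rcases le_or_gt z 0 with h | h
    · simp [hzero z h]
    · have : x ≤ z := le_of_not_ge fun hzx => hz ⟨h, hzx⟩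
      simp [max_eq_right (sub_nonpos.2 this), hn]

/-- Smooth functions of `1 / t` with compact support are mixtures of Williamson kernels. -/
lemma exists_williamson_representation {F : ℝ → ℝ} {n : ℕ} (hn : n ≠ 0) (hF : ContDiff ℝ ∞ F)
    (hc : HasCompactSupport F) (hsupp : tsupport F ⊆ Set.Ioi 0) :
    ∃ g : ℝ → ℝ, Continuous g ∧ HasCompactSupport g ∧ (∀ z ≤ 0, g z = 0) ∧
      ∀ t : ℝ, 0 < t → F t⁻¹ = ∫ z, (max (1 - t * z) 0) ^ n * g z := by
  -- The factor `x ^ n` at `x = 1/t` cancels the `t⁻ⁿ` in `(1/t - z)₊ⁿ = t⁻ⁿ (1 - t z)₊ⁿ`.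
  set f : ℝ → ℝ := fun x => x ^ n * F x with hfdef
  have hf : ContDiff ℝ ∞ f := by fun_prop
  have hfF : tsupport f ⊆ tsupport F := tsupport_mul_subset_right
  have hzero : ∀ z, z ∉ tsupport F → iteratedDeriv (n + 1) f z = 0 := fun z hz =>
    iteratedDeriv_eq_zero_of_notMem_tsupport (fun h => hz (hfF h)) _
  refine ⟨fun z => iteratedDeriv (n + 1) f z / n.factorial, ?_, ?_, fun z hz => ?_, fun t ht => ?_⟩
  · exact (hf.continuous_iteratedDeriv (n + 1) (by exact_mod_cast le_top)).div_const _
  · exact HasCompactSupport.intro hc fun z hz => by simp [hzero z hz]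
  · simp [hzero z fun h => (hsupp h).not_ge hz]
  · have h := eq_integral_iteratedDeriv hn hf (hfF.trans hsupp) (inv_pos.2 ht)
    have hker : ∀ z, (max (t⁻¹ - z) 0) ^ n = t⁻¹ ^ n * (max (1 - t * z) 0) ^ n := fun z => by
      rw [← mul_pow, mul_max_of_nonneg _ _ (inv_pos.2 ht).le, mul_zero, mul_sub, mul_one,
        inv_mul_cancel_left₀ ht.ne']
    simp_rw [hker, mul_assoc, integral_const_mul] at h
    exact mul_left_cancel₀ (pow_ne_zero n (inv_ne_zero ht.ne')) h

lemma integral_mixture {d : ℕ} {γ : ProbabilityMeasure ℝ≥0} {ψ : ℝ≥0 → I}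
    (hγ : IsWilliamsonMeasure d γ ψ) {g : ℝ → ℝ} (hg : Continuous g) (hc : HasCompactSupport g)
    (hg0 : ∀ z ≤ 0, g z = 0) :
    ∫ t : ℝ≥0, (∫ z, (max (1 - (t : ℝ) * z) 0) ^ (d - 1) * g z) ∂(γ : Measure ℝ≥0) =
      ∫ z, (ψ z.toNNReal : ℝ) * g z := by
  rw [integral_integral_swap]
  · refine integral_congr_ae (Eventually.of_forall fun z => ?_)
    rcases le_or_gt z 0 with hz | hz
    · simp [hg0 z hz]
    · simp only [integral_mul_const]
      rw [hγ.eq_williamson _ (Real.toNNReal_pos.2 hz), williamson, Real.coe_toNNReal z hz.le]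
  · have hgi : Integrable (fun p : ℝ≥0 × ℝ => g p.2) ((γ : Measure ℝ≥0).prod volume) :=
      (hg.integrable_of_hasCompactSupport hc).comp_snd _
    refine hgi.norm.mono' (Continuous.aestronglyMeasurable ?_) (Eventually.of_forall fun p => ?_)
    · simp only [Function.uncurry_def]
      fun_prop
    -- For `z < 0` the kernel may be unbounded in `t`; there `g` vanishes.
    · rcases le_or_gt p.2 0 with hz | hz
      · simp [Function.uncurry_def, hg0 _ hz]
      · simp only [Function.uncurry_def, norm_mul]
        refine mul_le_of_le_one_left (norm_nonneg _) ?_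
        rw [Real.norm_of_nonneg (by positivity)]
        exact pow_le_one₀ (le_max_right _ _)
          (max_le (sub_le_self _ (mul_nonneg p.1.2 hz.le)) zero_le_one)

lemma tendsto_integral_comp_inv {d : ℕ} (hd : 2 ≤ d) {γ : ProbabilityMeasure ℝ≥0}
    {γn : ℕ → ProbabilityMeasure ℝ≥0} {ψ : ℝ≥0 → I} {ψn : ℕ → ℝ≥0 → I}
    (hγ : IsWilliamsonMeasure d γ ψ) (hγn : ∀ n, IsWilliamsonMeasure d (γn n) (ψn n))
    (hψn : ∀ n, Continuous (ψn n)) (hlim : ∀ z, Tendsto (fun n => ψn n z) atTop (𝓝 (ψ z)))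
    {F : ℝ → ℝ} (hF : ContDiff ℝ ∞ F) (hc : HasCompactSupport F)
    (hsupp : tsupport F ⊆ Set.Ioi 0) :
    Tendsto (fun n => ∫ t : ℝ≥0, F (t : ℝ)⁻¹ ∂(γn n : Measure ℝ≥0)) atTop
      (𝓝 (∫ t : ℝ≥0, F (t : ℝ)⁻¹ ∂(γ : Measure ℝ≥0))) := by
  obtain ⟨g, hg, hgc, hg0, hFg⟩ :=
    exists_williamson_representation (n := d - 1) (by omega) hF hc hsupp
  have key : ∀ {γ : ProbabilityMeasure ℝ≥0} {ψ : ℝ≥0 → I}, IsWilliamsonMeasure d γ ψ →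
      ∫ t : ℝ≥0, F (t : ℝ)⁻¹ ∂(γ : Measure ℝ≥0) = ∫ z, (ψ z.toNNReal : ℝ) * g z := by
    intro γ ψ hγ
    rw [← integral_mixture hγ hg hgc hg0]
    refine integral_congr_ae ?_
    have hne : ∀ᵐ t ∂(γ : Measure ℝ≥0), t ≠ 0 := by
      rw [ae_iff]
      simpa using hγ.no_atom_zero
    filter_upwards [hne] with t ht
    exact hFg t (NNReal.coe_pos.2 (pos_iff_ne_zero.2 ht))
  simp_rw [key hγ, key (hγn _)]
  refine tendsto_integral_of_dominated_convergence (fun z => ‖g z‖) (fun n => ?_)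
    (hg.integrable_of_hasCompactSupport hgc).norm (fun n => ?_) ?_
  · have := hψn n
    exact Continuous.aestronglyMeasurable (by fun_prop)
  · refine Eventually.of_forall fun z => ?_
    rw [norm_mul, Real.norm_of_nonneg (ψn n _).2.1]
    exact mul_le_of_le_one_left (norm_nonneg _) (ψn n _).2.2
  · exact Eventually.of_forall fun z =>
      (((continuous_subtype_val.tendsto _).comp (hlim z.toNNReal)).mul_const _)

lemma exists_contDiff_cutoff {K U : Set ℝ} (hK : IsCompact K) (hU : IsOpen U) (hKU : K ⊆ U) :
    ∃ F : ℝ → ℝ, ContDiff ℝ ∞ F ∧ HasCompactSupport F ∧ tsupport F ⊆ U ∧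
      (∀ x, F x ∈ Set.Icc 0 1) ∧ ∀ x ∈ K, F x = 1 := by
  obtain ⟨L, hL, hKL, hLU⟩ := exists_compact_between hK hU hKU
  obtain ⟨F, hF, hrange, hsupp, hone⟩ := exists_contMDiff_support_eq_eq_one_iff
    (modelWithCornersSelf ℝ ℝ) (n := ⊤) isOpen_interior hK.isClosed hKL
  have hts : tsupport F ⊆ L :=
    closure_minimal (hsupp.subset.trans interior_subset) hL.isClosed
  exact ⟨F, hF.contDiff, hL.of_isClosed_subset (isClosed_tsupport F) hts, hts.trans hLU,
    fun x => hrange ⟨x, rfl⟩, fun x hx => (hone x).1 hx⟩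

/-- Pointwise convergence of generators implies weak convergence of their Williamson measures. -/
lemma tendsto_williamsonMeasure {d : ℕ} (hd : 2 ≤ d) {γ : ProbabilityMeasure ℝ≥0}
    {γn : ℕ → ProbabilityMeasure ℝ≥0} {ψ : ℝ≥0 → I} {ψn : ℕ → ℝ≥0 → I}
    (hγ : IsWilliamsonMeasure d γ ψ) (hγn : ∀ n, IsWilliamsonMeasure d (γn n) (ψn n))
    (hψn : ∀ n, Continuous (ψn n)) (hlim : ∀ z, Tendsto (fun n => ψn n z) atTop (𝓝 (ψ z))) :
    Tendsto γn atTop (𝓝 γ) := by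
  refine tendsto_of_forall_isOpen_le_liminf_nat' fun G hG => ?_
  -- Discarding `0` lets inner regularity choose a compact `K` on which inversion is continuous.
  rw [← measure_sdiff_null hγ.no_atom_zero]
  refine le_of_forall_lt fun r hr => ?_
  obtain ⟨K, hKG, hK, hrK⟩ := (hG.sdiff isClosed_singleton).exists_lt_isCompact hr
  set U : Set ℝ := Set.Ioi 0 ∩ (fun x : ℝ => x.toNNReal⁻¹) ⁻¹' G
  have hU : IsOpen U := by
    refine ContinuousOn.isOpen_inter_preimage (fun x hx => ?_) isOpen_Ioi hG
    exact (continuous_real_toNNReal.continuousAt.inv₀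
      (Real.toNNReal_pos.2 hx).ne').continuousWithinAt
  have hK' : IsCompact ((fun t : ℝ≥0 => (t : ℝ)⁻¹) '' K) := by
    refine hK.image_of_continuousOn fun t ht => ?_
    exact (NNReal.continuous_coe.continuousAt.inv₀
      (NNReal.coe_ne_zero.2 (hKG ht).2)).continuousWithinAt
  -- `t ↦ F(1/t)` lies between the indicators of `K` and `G`.
  obtain ⟨F, hF, hFc, hFU, hF01, hF1⟩ := exists_contDiff_cutoff hK' hU (by
    rintro _ ⟨t, ht, rfl⟩
    refine ⟨inv_pos.2 (NNReal.coe_pos.2 (pos_iff_ne_zero.2 (hKG ht).2)), ?_⟩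
    simpa [← NNReal.coe_inv] using (hKG ht).1)
  have hlimF := ENNReal.tendsto_ofReal (tendsto_integral_comp_inv hd hγ hγn hψn hlim hF hFc
    (hFU.trans Set.inter_subset_left))
  have hmeas : Measurable fun t : ℝ≥0 => F (t : ℝ)⁻¹ :=
    hF.continuous.measurable.comp (by fun_prop)
  have hlint : ∀ μ : ProbabilityMeasure ℝ≥0,
      ENNReal.ofReal (∫ t : ℝ≥0, F (t : ℝ)⁻¹ ∂(μ : Measure ℝ≥0)) =
        ∫⁻ t : ℝ≥0, ENNReal.ofReal (F (t : ℝ)⁻¹) ∂(μ : Measure ℝ≥0) := fun μ => by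
    refine ofReal_integral_eq_lintegral_ofReal ?_ (Eventually.of_forall fun t => (hF01 _).1)
    refine Integrable.of_bound hmeas.aestronglyMeasurable 1 (Eventually.of_forall fun t => ?_)
    rw [Real.norm_of_nonneg (hF01 _).1]
    exact (hF01 _).2
  have hlower : (γ : Measure ℝ≥0) K ≤
      ENNReal.ofReal (∫ t : ℝ≥0, F (t : ℝ)⁻¹ ∂(γ : Measure ℝ≥0)) := by
    rw [hlint, ← lintegral_indicator_one hK.measurableSet]
    refine lintegral_mono fun t => ?_
    by_cases ht : t ∈ K
    · simp [ht, hF1 _ ⟨t, ht, rfl⟩]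
    · simp [ht]
  have hupper : ∀ n, ENNReal.ofReal (∫ t : ℝ≥0, F (t : ℝ)⁻¹ ∂(γn n : Measure ℝ≥0)) ≤
      (γn n : Measure ℝ≥0) G := fun n => by
    rw [hlint, ← lintegral_indicator_one hG.measurableSet]
    refine lintegral_mono fun t => ?_
    by_cases ht : t ∈ G
    · simpa [ht] using (hF01 _).2
    · have hFt : F (t : ℝ)⁻¹ = 0 := image_eq_zero_of_notMem_tsupport fun h => ht (by
        simpa [← NNReal.coe_inv] using (hFU h).2)
      simp [hFt]
  calc r < _ := hrK
    _ ≤ _ := hlower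
    _ = _ := hlimF.liminf_eq.symm
    _ ≤ _ := liminf_le_liminf (Eventually.of_forall hupper)

end Inversion

/-- Weak convergence of Williamson measures implies pointwise convergence of the generators. -/
lemma tendsto_generator_of_tendsto_measure {d : ℕ} {γ : ProbabilityMeasure ℝ≥0}
    {γn : ℕ → ProbabilityMeasure ℝ≥0} {ψ : ℝ≥0 → I} {ψn : ℕ → ℝ≥0 → I}
    (hγ : IsWilliamsonMeasure d γ ψ) (hγn : ∀ n, IsWilliamsonMeasure d (γn n) (ψn n))
    (h : Tendsto γn atTop (𝓝 γ)) {z : ℝ≥0} (hz : 0 < z) :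
    Tendsto (fun n => ψn n z) atTop (𝓝 (ψ z)) := by
  rw [tendsto_subtype_rng]
  simp_rw [hγ.eq_williamson z hz, (hγn _).eq_williamson z hz, williamson]
  have hcont : Continuous fun t : ℝ≥0 => (max (1 - (t : ℝ) * (z : ℝ)) 0) ^ (d - 1) := by fun_prop
  refine ProbabilityMeasure.tendsto_iff_forall_integral_tendsto.1 h
    (BoundedContinuousFunction.ofNormedAddCommGroup _ hcont 1 fun t => ?_)
  rw [Real.norm_of_nonneg (by positivity)]
  exact pow_le_one₀ (le_max_right _ _)
    (max_le (sub_le_self _ (mul_nonneg t.2 z.2)) zero_le_one)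

end ArchCopula

theorem mainTheorem3 (d : ℕ) (hd : 3 ≤ d)
    (C : (Fin d → I) → I) (Cn : ℕ → (Fin d → I) → I)
    (ψ : ℝ≥0 → I) (ψn : ℕ → ℝ≥0 → I)
    (hC : ArchCopula.IsArchimedeanCopula C ψ)
    (hCn : ∀ n, ArchCopula.IsArchimedeanCopula (Cn n) (ψn n))
    (γ : ProbabilityMeasure ℝ≥0) (γn : ℕ → ProbabilityMeasure ℝ≥0)
    (hγ : ArchCopula.IsWilliamsonMeasure d γ ψ)
    (hγn : ∀ n, ArchCopula.IsWilliamsonMeasure d (γn n) (ψn n)) :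
    TendstoUniformly Cn C atTop ↔ Tendsto γn atTop (𝓝 γ) := by
  have hgen := fun n => (hCn n).isGenerator
  obtain rfl : C = ArchCopula.archimedean d ψ := funext hC.eq_archimedean
  obtain rfl : Cn = fun n => ArchCopula.archimedean d (ψn n) :=
    funext fun n => funext (hCn n).eq_archimedean
  have hone : ∀ n, ψn n 1 = ψ 1 := fun n =>
    Subtype.ext ((hCn n).normalized.trans hC.normalized.symm)
  have hpos : 0 < ψ 1 := Subtype.coe_lt_coe.1 (by rw [hC.normalized]; norm_num)
  constructor
  · intro h
    refine ArchCopula.tendsto_williamsonMeasure (by omega) hγ hγn (fun n => (hgen n).continuous)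
      fun z => ArchCopula.tendsto_generator hC.isGenerator hgen (by omega) hpos ?_ h z
    simp [hone]
  · intro h
    refine ArchCopula.tendstoUniformly_archimedean hC.isGenerator hgen (fun z => ?_) d
    rcases eq_or_ne z 0 with rfl | hz
    · simp [hC.isGenerator.map_zero, (hgen _).map_zero]
    · exact ArchCopula.tendsto_generator_of_tendsto_measure hγ hγn h (pos_iff_ne_zero.2 hz)
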